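/- Let $m=n+d$ with integers $n,d\ge 0$, let $1\le k\le m$, and let $\bar v_1,\dots,\bar v_m\in\mathbb{R}^n$ be the rows of a real $m\times n$ matrix of rank $n$. Let $T:\mathbb{R}^n\to\mathbb{R}^m$, $Tu=(\langle\bar v_1,u\rangle,\dots,\langle\bar v_m,u\rangle)$, be the linear map with this matrix, and let $L\subset\mathbb{R}^m$ be the image of $T$, an $n$-dimensional linear subspace; write $\operatorname{proj}_L$ for the orthogonal projection of $\mathbb{R}^m$ onto $L$. Let $C_{\pm1/2}(m)=\{x\in\mathbb{R}^m:-\tfrac12\le x_i\le\tfrac12 \text{ for all } i\}$ and let $E(m,k)$ be the convex hull of all vectors in $\{0,1,-1\}^m$ with exactly $k$ non-zero entries. A polytope $P\subset\mathbb{R}^d$ is centrally symmetric (cs) if $P=-P$, and a cs polytope is $k$-neighborly if every set of $k$ of its vertices, no two of which are antipodes, is the vertex set of a face of $P$. The (indexed) set $\{\pm\bar v_1,\dots,\pm\bar v_m\}$ is called a cs-transform of a cs $d$-polytope with $2m$ vertices if the vertices of the polytope can be labelled $\pm v_1,\dots,\pm v_m$ such that the columns of the matrix with rows $\bar v_1,\dots,\bar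 v_m$ form a basis of the space $\{\alpha\in\mathbb{R}^m:\sum_i\alpha_iv_i=0\}$ of linear dependences of $v_1,\dots,v_m$. Then $\{\pm\bar v_1,\dots,\pm\bar v_m\}$ is a cs-transform of a $k$-neighborly cs $d$-polytope with $2m$ vertices if and only if $$\operatorname{proj}_L E(m,k)\ \subset\ \operatorname{int}_L\big(\operatorname{proj}_L C_{\pm1/2}(m)\big),$$ where $\operatorname{int}_L$ denotes the interior relative to $L$. -/

import Mathlib

/-- A polytope: the convex hull of a finite set of points. -/
def IsPolytope {d : ℕ} (P : Set (EuclideanSpace ℝ (Fin d))) : Prop :=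
  ∃ S : Set (EuclideanSpace ℝ (Fin d)), S.Finite ∧ P = convexHull ℝ S

/-- A `d`-polytope in `ℝ^d`: a polytope of full dimension `d`. -/
def IsFullDimPolytope {d : ℕ} (P : Set (EuclideanSpace ℝ (Fin d))) : Prop :=
  IsPolytope P ∧ affineSpan ℝ P = ⊤

/-- `P` is centrally symmetric: `P = -P`. -/
def IsCentrallySymmetric {d : ℕ} (P : Set (EuclideanSpace ℝ (Fin d))) : Prop :=
  ∀ x, x ∈ P ↔ -x ∈ P

/-- A cs polytope `P` is `k`-neighborly if every set of `k` of its vertices, no two of which are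
antipodes, is the vertex set of a face of `P`. The vertices of a polytope are its extreme points,
and its faces are its exposed faces (sets of maximizers of linear functionals). -/
def IsKNeighborly {d : ℕ} (k : ℕ) (P : Set (EuclideanSpace ℝ (Fin d))) : Prop :=
  ∀ S : Finset (EuclideanSpace ℝ (Fin d)),
    (S : Set (EuclideanSpace ℝ (Fin d))) ⊆ P.extremePoints ℝ →
    S.card = k →
    (∀ x ∈ S, ∀ y ∈ S, x ≠ y → y ≠ -x) →
    ∃ F : Set (EuclideanSpace ℝ (Fin d)),
      IsExposed ℝ P F ∧ F.extremePoints ℝ = (S : Set (EuclideanSpace ℝ (Fin d)))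

/-- The centrally symmetric set `{±v_1, …, ±v_m}`. -/
def plusMinus {m d : ℕ} (v : Fin m → EuclideanSpace ℝ (Fin d)) :
    Set (EuclideanSpace ℝ (Fin d)) :=
  {x | ∃ i, x = v i ∨ x = -v i}

/-- The space of linear dependences `{α ∈ ℝ^m : ∑ i, α_i v_i = 0}`. -/
def linearDependences {m d : ℕ} (v : Fin m → EuclideanSpace ℝ (Fin d)) :
    Submodule ℝ (EuclideanSpace ℝ (Fin m)) where
  carrier := {α | ∑ i, α i • v i = 0}
  add_mem' := by
    intro a b ha hb
    simp only [Set.mem_ofPred_eq] at ha hb ⊢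
    simp [add_smul, Finset.sum_add_distrib, ha, hb]
  zero_mem' := by simp
  smul_mem' := by
    intro c a ha
    simp only [Set.mem_ofPred_eq] at ha ⊢
    simp [mul_smul, ← Finset.smul_sum, ha]

/-- The `m × n` matrix with rows `u_1, …, u_m`. -/
def rowMatrix {m n : ℕ} (u : Fin m → EuclideanSpace ℝ (Fin n)) : Matrix (Fin m) (Fin n) ℝ :=
  Matrix.of fun i j => u i j

/-- The `j`-th column of the matrix with rows `u_1, …, u_m`. -/
def matrixColumn {m n : ℕ} (u : Fin m → EuclideanSpace ℝ (Fin n)) (j : Fin n) :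
    EuclideanSpace ℝ (Fin m) :=
  WithLp.toLp 2 fun i => rowMatrix u i j

/-- `{±u_1, …, ±u_m} ⊂ ℝ^n` is a cs-transform of `{±v_1, …, ±v_m} ⊂ ℝ^d`: the `u_i` are the rows
of an `m × n` matrix whose columns form a basis of the space of linear dependences of
`v_1, …, v_m`. (As for Gale transforms, the `u_i` are indexed, and may coincide or be zero.) -/
def IsCsTransform {m n d : ℕ} (u : Fin m → EuclideanSpace ℝ (Fin n))
    (v : Fin m → EuclideanSpace ℝ (Fin d)) : Prop :=
  LinearIndependent ℝ (matrixColumn u) ∧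
    Submodule.span ℝ (Set.range (matrixColumn u)) = linearDependences v

/-- `{±u_1, …, ±u_m}` is a cs-transform of (the vertex set of) the cs polytope `P`. -/
def IsCsTransformOfPolytope {m n d : ℕ} (u : Fin m → EuclideanSpace ℝ (Fin n))
    (P : Set (EuclideanSpace ℝ (Fin d))) : Prop :=
  ∃ v : Fin m → EuclideanSpace ℝ (Fin d), P.extremePoints ℝ = plusMinus v ∧ IsCsTransform u v

/-- The cube `C_{±a}(m) = {x ∈ ℝ^m : -a ≤ x_i ≤ a for all i}`. -/
def cube (a : ℝ) (m : ℕ) : Set (EuclideanSpace ℝ (Fin m)) :=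
  {x | ∀ i, -a ≤ x i ∧ x i ≤ a}

/-- `E(m,k)`: the convex hull of all `0/±1`-vectors of length `m` with exactly `k` non-zero
entries. -/
def polytopeE (m k : ℕ) : Set (EuclideanSpace ℝ (Fin m)) :=
  convexHull ℝ {x | (∀ i, x i = 0 ∨ x i = 1 ∨ x i = -1) ∧ {i | x i ≠ 0}.ncard = k}

/-- The linear map `T : ℝ^n → ℝ^m`, `T x = (⟨u_1, x⟩, …, ⟨u_m, x⟩)`, whose matrix has rows
`u_1, …, u_m`. -/
noncomputable def rowMap {m n : ℕ} (u : Fin m → EuclideanSpace ℝ (Fin n)) :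
    EuclideanSpace ℝ (Fin n) →ₗ[ℝ] EuclideanSpace ℝ (Fin m) :=
  Matrix.toEuclideanLin (rowMatrix u)

/-- The image `proj_L S` of a set `S ⊆ ℝ^m` under orthogonal projection to the linear subspace
`L`, as a subset of `L` (with the topology of `L`). -/
noncomputable def projOnto {m : ℕ} (L : Submodule ℝ (EuclideanSpace ℝ (Fin m)))
    (S : Set (EuclideanSpace ℝ (Fin m))) : Set L :=
  L.orthogonalProjectionOnto '' S

open Module

/-! Both sides are statements about `Lᗮ`. If `L` is the space of dependences of the `v i`, then `Lᗮ`
consists of the vectors of values `l (v i)` of linear functionals `l`. The inclusion of projections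
says that each sign vector `x` with `k` non-zero entries has sup-norm distance less than 1/2 from
`Lᗮ` (`mem_interior_projOnto_cube_iff`); neighborliness asks for some `y ∈ Lᗮ` equal to `x` on its
support and smaller than 1 in absolute value elsewhere.

Such a `y`, scaled to slightly more than half, is within 1/2 of `x` (`exists_scale_close`). The
converse cannot merely rescale, since closeness does not give equality on the support. Instead,
pairing with `α ∈ L` shows that any `k` coordinates of `α` carry less ℓ¹-mass than the others,
uniformly (`exists_sum_abs_le_mul_sum_compl`); by Hahn–Banach this dual estimate gives exact
interpolation (`exists_mem_orthogonal_eq_on`). Projecting the standard basis to `Lᗮ` then yields the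
vertices. -/

/-- The vectors of `{0, 1, -1}^m` with exactly `k` non-zero entries. -/
def signVectors (m k : ℕ) : Set (EuclideanSpace ℝ (Fin m)) :=
  {x | (∀ i, x i = 0 ∨ x i = 1 ∨ x i = -1) ∧ {i | x i ≠ 0}.ncard = k}

/-! ### Projections and sup-norm distance to `Lᗮ`. -/

/-- Projection to `L` is an open map with kernel `Lᗮ`, so it carries the open cube to an open set,
and two points have the same image exactly when they differ by an element of `Lᗮ`. -/
theorem mem_interior_projOnto_cube_iff {m : ℕ} (L : Submodule ℝ (EuclideanSpace ℝ (Fin m)))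
    (x : EuclideanSpace ℝ (Fin m)) :
    L.orthogonalProjectionOnto x ∈ interior (projOnto L (cube (1 / 2) m)) ↔
      ∃ y ∈ Lᗮ, ∃ r < (1 / 2 : ℝ), ∀ i, |x i - y i| ≤ r := by
  constructor
  · intro h
    set p := L.orthogonalProjectionOnto x with hp
    -- An interior point can be pushed outward by a factor `1 + t` inside the image; shrinking back
    -- leaves the radius `(1 + t)⁻¹ / 2 < 1/2`.
    have hc : Filter.Tendsto (fun t : ℝ => (1 + t) • p) (nhdsWithin 0 (Set.Ioi 0)) (nhds p) := by
      have : Continuous (fun t : ℝ => (1 + t) • p) := by fun_prop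
      have h0 := this.tendsto 0
      simp only [add_zero, one_smul] at h0
      exact h0.mono_left nhdsWithin_le_nhds
    have he := hc.eventually (mem_interior_iff_mem_nhds.1 h)
    obtain ⟨t, ⟨z, hz, hzp⟩, ht⟩ := (he.and self_mem_nhdsWithin).exists
    have ht0 : (0 : ℝ) < t := ht
    have h1 : (0 : ℝ) < 1 + t := by linarith
    refine ⟨x - (1 + t)⁻¹ • z, ?_, (1 + t)⁻¹ * (1 / 2), ?_, ?_⟩
    · rw [← Submodule.orthogonalProjectionOnto_eq_zero_iff, map_sub, map_smul, hzp, smul_smul,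
        inv_mul_cancel₀ h1.ne', one_smul, hp, sub_self]
    · have : (1 + t)⁻¹ < 1 := inv_lt_one_of_one_lt₀ (by linarith)
      linarith
    · intro i
      have : x i - (x - (1 + t)⁻¹ • z) i = (1 + t)⁻¹ * z i := by simp
      rw [this, abs_mul, abs_of_pos (inv_pos.2 h1)]
      exact mul_le_mul_of_nonneg_left (abs_le.2 (hz i)) (inv_pos.2 h1).le
  · rintro ⟨y, hy, r, hr, h⟩
    have hopen : IsOpen {z : EuclideanSpace ℝ (Fin m) | ∀ i, |z i| < 1 / 2} := by
      simp only [Set.ofPred_forall]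
      exact isOpen_iInter_of_finite fun i => isOpen_lt (by fun_prop) continuous_const
    have hsurj : Function.Surjective L.orthogonalProjectionOnto := fun a =>
      ⟨a, Submodule.orthogonalProjectionOnto_mem_subspace_eq_self a⟩
    have himg := L.orthogonalProjectionOnto.isOpenMap hsurj _ hopen
    refine interior_maximal ?_ himg ⟨x - y, fun i => ?_, ?_⟩
    · exact Set.image_mono fun z hz i => abs_le.1 (hz i).le
    · simpa using (h i).trans_lt hr
    · rw [map_sub, Submodule.orthogonalProjectionOnto_eq_zero_iff.2 hy, sub_zero]

theorem convex_cube (a : ℝ) (m : ℕ) : Convex ℝ (cube a m) := by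
  have : cube a m = (EuclideanSpace.equiv (Fin m) ℝ).toLinearMap ⁻¹'
      Set.Icc (fun _ => -a) (fun _ => a) := by
    ext x
    simp [cube, Pi.le_def, forall_and]
  rw [this]
  exact (convex_Icc _ _).linear_preimage _

theorem projOnto_polytopeE_subset_iff {m : ℕ} (k : ℕ)
    (L : Submodule ℝ (EuclideanSpace ℝ (Fin m))) :
    projOnto L (polytopeE m k) ⊆ interior (projOnto L (cube (1 / 2) m)) ↔
      ∀ x ∈ signVectors m k, ∃ y ∈ Lᗮ, ∃ r < (1 / 2 : ℝ), ∀ i, |x i - y i| ≤ r := by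
  simp only [← mem_interior_projOnto_cube_iff]
  constructor
  · exact fun h x hx => h ⟨x, subset_convexHull ℝ _ hx, rfl⟩
  · intro h
    have hconv : Convex ℝ (interior (projOnto L (cube (1 / 2) m))) :=
      ((convex_cube _ _).linear_image L.orthogonalProjectionOnto.toLinearMap).interior
    rw [projOnto, Set.image_subset_iff]
    exact convexHull_min h (hconv.linear_preimage L.orthogonalProjectionOnto.toLinearMap)

/-! ### From neighborliness to closeness. -/

theorem plusMinus_eq_range {m d : ℕ} (v : Fin m → EuclideanSpace ℝ (Fin d)) :
    plusMinus v = Set.range (Sum.elim v (-v)) := by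
  ext x
  simp only [plusMinus, Set.mem_ofPred_eq, Set.mem_range, Sum.exists, Sum.elim_inl, Sum.elim_inr,
    Pi.neg_apply, exists_or, eq_comm]

theorem ncard_plusMinus_iff {m d : ℕ} (v : Fin m → EuclideanSpace ℝ (Fin d)) :
    (plusMinus v).ncard = 2 * m ↔ Function.Injective (Sum.elim v (-v)) := by
  classical
  have h : (plusMinus v).ncard = (Finset.univ.image (Sum.elim v (-v))).card := by
    rw [plusMinus_eq_range, ← Set.ncard_coe_finset]
    simp
  have hc : 2 * m = (Finset.univ : Finset (Fin m ⊕ Fin m)).card := by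
    simp [two_mul]
  rw [h, hc, Finset.card_image_iff, Finset.coe_univ, Set.injOn_univ]

theorem injective_sum_elim_neg_iff {m d : ℕ} (v : Fin m → EuclideanSpace ℝ (Fin d)) :
    Function.Injective (Sum.elim v (-v)) ↔
      Function.Injective v ∧ ∀ i j, v i ≠ -v j := by
  rw [Sum.elim_injective]
  constructor
  · exact fun h => ⟨h.1, h.2.2⟩
  · exact fun h => ⟨h.1, neg_injective.comp h.1, h.2⟩

theorem inner_mem_orthogonal_linearDependences {m d : ℕ} (v : Fin m → EuclideanSpace ℝ (Fin d))
    (l : EuclideanSpace ℝ (Fin d) →L[ℝ] ℝ) :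
    WithLp.toLp 2 (fun i => l (v i)) ∈ (linearDependences v)ᗮ := by
  rw [Submodule.mem_orthogonal]
  intro α hα
  have hα' : ∑ i, α i • v i = 0 := hα
  have := congrArg l hα'
  simp only [map_sum, map_smul, smul_eq_mul, map_zero] at this
  rw [← this, PiLp.inner_apply]
  exact Finset.sum_congr rfl fun i _ => by simp [mul_comm]

/-- The vertices `x i • v i` over the support of `x` span an exposed face; the functional exposing
it, divided by its maximum, is the one required. -/
theorem exists_functional_of_isKNeighborly {m d k : ℕ} (hk : 1 ≤ k)
    {P : Set (EuclideanSpace ℝ (Fin d))} (hP : IsKNeighborly k P)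
    {v : Fin m → EuclideanSpace ℝ (Fin d)} (hv : P.extremePoints ℝ = plusMinus v)
    (hinj : Function.Injective v) (hneg : ∀ i j, v i ≠ -v j)
    {x : EuclideanSpace ℝ (Fin m)} (hx : x ∈ signVectors m k) :
    ∃ l : EuclideanSpace ℝ (Fin d) →L[ℝ] ℝ,
      (∀ i, x i ≠ 0 → l (v i) = x i) ∧ ∀ i, x i = 0 → |l (v i)| < 1 := by
  classical
  obtain ⟨hx1, hx2⟩ := hx
  set I : Finset (Fin m) := Finset.univ.filter fun i => x i ≠ 0 with hI
  have hIcard : I.card = k := by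
    rw [← hx2, ← Set.ncard_coe_finset]
    simp [hI]
  have hmemI : ∀ i, i ∈ I ↔ x i ≠ 0 := by simp [hI]
  have hsign : ∀ i ∈ I, x i = 1 ∨ x i = -1 := fun i hi =>
    (hx1 i).resolve_left ((hmemI i).1 hi)
  set w : Fin m → EuclideanSpace ℝ (Fin d) := fun i => x i • v i with hw
  have key : ∀ i ∈ I, ∀ j, (w i = v j → i = j ∧ x j = 1) ∧ (w i = -v j → i = j ∧ x j = -1) := by
    intro i hi j
    rcases hsign i hi with h | h
    · simp only [hw, h, one_smul]
      exact ⟨fun e => by have := hinj e; subst this; exact ⟨rfl, h⟩, fun e => absurd e (hneg i j)⟩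
    · simp only [hw, h, neg_smul, one_smul]
      exact ⟨fun e => absurd e.symm (hneg j i),
        fun e => by have := hinj (neg_injective e); subst this; exact ⟨rfl, h⟩⟩
  have hwI : ∀ i ∈ I, w i = v i ∨ w i = -v i := by
    intro i hi
    rcases hsign i hi with h | h <;> simp [hw, h]
  have hPw : ∀ i ∈ I, w i ∈ P.extremePoints ℝ := fun i hi => by
    rw [hv]; exact ⟨i, hwI i hi⟩
  have hanti : ∀ i ∈ I, ∀ j ∈ I, w j ≠ -w i := by
    intro i hi j hj h
    rcases hwI i hi with e | e
    · rw [e] at h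
      obtain ⟨e1, e2⟩ := (key j hj i).2 h
      obtain ⟨-, e3⟩ := (key i hi i).1 e
      linarith
    · rw [e, neg_neg] at h
      obtain ⟨e1, e2⟩ := (key j hj i).1 h
      obtain ⟨-, e3⟩ := (key i hi i).2 e
      linarith
  obtain ⟨F, hF, hFS⟩ := hP (I.image w) (by
      intro y hy
      obtain ⟨i, hi, rfl⟩ := Finset.mem_image.1 (Finset.mem_coe.1 hy)
      exact hPw i hi) (by
      rw [Finset.card_image_of_injOn, hIcard]
      intro i hi j hj hij
      rcases hwI j hj with e | e
      · exact ((key i hi j).1 (hij.trans e)).1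
      · exact ((key i hi j).2 (hij.trans e)).1) (by
      intro a ha b hb _
      obtain ⟨i, hi, rfl⟩ := Finset.mem_image.1 ha
      obtain ⟨j, hj, rfl⟩ := Finset.mem_image.1 hb
      exact hanti i hi j hj)
  have hwF : ∀ i ∈ I, w i ∈ F := fun i hi => by
    have : w i ∈ F.extremePoints ℝ := by
      rw [hFS]; exact Finset.mem_coe.2 (Finset.mem_image_of_mem w hi)
    exact this.1
  have hFI : ∀ y ∈ F, y ∈ plusMinus v → ∃ i ∈ I, w i = y := fun y hy hyv => by
    have : y ∈ F.extremePoints ℝ := by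
      rw [hF.isExtreme.extremePoints_eq]
      exact ⟨hy, hv ▸ hyv⟩
    rw [hFS] at this
    exact Finset.mem_image.1 (Finset.mem_coe.1 this)
  obtain ⟨i₀, hi₀⟩ : I.Nonempty := Finset.card_pos.1 (by omega)
  obtain ⟨l, hl⟩ := hF ⟨_, hwF i₀ hi₀⟩
  have hmem : ∀ y, y ∈ plusMinus v → y ∈ P := fun y hy => by
    rw [← hv] at hy; exact hy.1
  have hmax : ∀ i ∈ I, ∀ y ∈ P, l y ≤ l (w i) := fun i hi y hy => by
    have := hwF i hi
    rw [hl] at this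
    exact this.2 y hy
  set c := l (w i₀) with hc
  have hconst : ∀ i ∈ I, l (w i) = c := fun i hi =>
    le_antisymm (hmax i₀ hi₀ _ (hPw i hi).1) (hmax i hi _ (hPw i₀ hi₀).1)
  have hlt : ∀ y ∈ plusMinus v, (∀ i ∈ I, w i ≠ y) → l y < c := by
    intro y hy hne
    refine lt_of_le_of_ne (hmax i₀ hi₀ y (hmem y hy)) fun e => ?_
    obtain ⟨i, hi, h⟩ := hFI y (by
      rw [hl]
      exact ⟨hmem y hy, fun z hz => e ▸ hmax i₀ hi₀ z hz⟩) hy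
    exact hne i hi h
  -- The antipode of a vertex of the face is a vertex outside it, so `-c < c`.
  have hcpos : 0 < c := by
    have h1 : -w i₀ ∈ plusMinus v := by
      refine ⟨i₀, ?_⟩
      rcases hwI i₀ hi₀ with e | e <;> simp [e]
    have := hlt _ h1 fun i hi => hanti i₀ hi₀ i hi
    rw [map_neg] at this
    linarith
  refine ⟨c⁻¹ • l, fun i hi => ?_, fun i hi => ?_⟩
  · have hiI := (hmemI i).2 hi
    have := hconst i hiI
    simp only [hw, map_smul, smul_eq_mul] at this
    simp only [smul_apply, smul_eq_mul]
    rcases hsign i hiI with e | e <;> rw [e] at this ⊢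
    · rw [one_mul] at this
      rw [this, inv_mul_cancel₀ hcpos.ne']
    · rw [show l (v i) = -c by linarith, mul_neg, inv_mul_cancel₀ hcpos.ne']
  · simp only [smul_apply, smul_eq_mul]
    rw [abs_mul, abs_of_pos (inv_pos.2 hcpos), inv_mul_lt_iff₀ hcpos, mul_one, abs_lt]
    have h1 := hlt (v i) ⟨i, Or.inl rfl⟩ fun j hj e => by
      have := ((key j hj i).1 e).2
      simp [hi] at this
    have h2 := hlt (-v i) ⟨i, Or.inr rfl⟩ fun j hj e => by
      have := ((key j hj i).2 e).2
      simp [hi] at this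
    rw [map_neg] at h2
    exact ⟨by linarith, h1⟩

theorem exists_scale_close {m k : ℕ} {x y : EuclideanSpace ℝ (Fin m)} (hx : x ∈ signVectors m k)
    (h1 : ∀ i, x i ≠ 0 → y i = x i) (h2 : ∀ i, x i = 0 → |y i| < 1) :
    ∃ s : ℝ, ∃ r < (1 / 2 : ℝ), ∀ i, |x i - (s • y) i| ≤ r := by
  obtain ⟨θ, hθ0, hθ1, hθ⟩ : ∃ θ : ℝ, 0 ≤ θ ∧ θ < 1 ∧ ∀ i, x i = 0 → |y i| ≤ θ := by
    have : ∀ i, ∃ t : ℝ, t < 1 ∧ (x i = 0 → |y i| ≤ t) := fun i => by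
      by_cases h : x i = 0
      · exact ⟨|y i|, h2 i h, fun _ => le_rfl⟩
      · exact ⟨0, one_pos, fun h' => absurd h' h⟩
    choose t ht ht' using this
    rcases isEmpty_or_nonempty (Fin m) with hm | hm
    · exact ⟨0, le_rfl, one_pos, fun i => hm.elim i⟩
    · obtain ⟨i, hi⟩ := Finite.exists_max t
      exact ⟨max 0 (t i), le_max_left _ _, max_lt one_pos (ht i),
        fun j hj => (ht' j hj).trans ((hi j).trans (le_max_right _ _))⟩
  -- A factor above 1/2 gains `(1 - θ) / 4` on the support; off it, the slack `1 - θ` keeps the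
  -- scaled entries below 1/2 by at least the same amount.
  refine ⟨1 / 2 + (1 - θ) / 4, 1 / 2 - (1 - θ) / 4, by linarith, fun i => ?_⟩
  simp only [PiLp.smul_apply, smul_eq_mul]
  rcases hx.1 i with h | h
  · rw [h, zero_sub, abs_neg, abs_mul, abs_of_pos (by linarith : 0 < 1 / 2 + (1 - θ) / 4)]
    calc (1 / 2 + (1 - θ) / 4) * |y i| ≤ (1 / 2 + (1 - θ) / 4) * θ :=
          mul_le_mul_of_nonneg_left (hθ i h) (by linarith)
      _ ≤ 1 / 2 - (1 - θ) / 4 := by nlinarith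
  · have h0 : x i ≠ 0 := by rcases h with h | h <;> rw [h] <;> norm_num
    rw [h1 i h0, abs_le]
    rcases h with h | h <;> rw [h] <;> constructor <;> linarith

/-! ### From closeness to exact interpolation. -/

theorem span_range_matrixColumn {m n : ℕ} (u : Fin m → EuclideanSpace ℝ (Fin n)) :
    Submodule.span ℝ (Set.range (matrixColumn u)) = LinearMap.range (rowMap u) := by
  rw [← Fintype.range_linearCombination]
  have h : rowMap u = (Fintype.linearCombination ℝ (matrixColumn u)).comp
      (WithLp.linearEquiv 2 ℝ (Fin n → ℝ)).toLinearMap := by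
    ext x i
    simp [rowMap, matrixColumn, Matrix.toLpLin_apply, Matrix.mulVec, dotProduct,
      Fintype.linearCombination_apply, mul_comm]
  rw [h, LinearMap.range_comp, LinearEquiv.range, Submodule.map_top]

theorem finrank_range_rowMap {m n : ℕ} (u : Fin m → EuclideanSpace ℝ (Fin n)) :
    finrank ℝ (LinearMap.range (rowMap u)) = (rowMatrix u).rank :=
  (Matrix.rank_eq_finrank_range_toLin (rowMatrix u) (PiLp.basisFun 2 ℝ (Fin m))
    (PiLp.basisFun 2 ℝ (Fin n))).symm

theorem linearIndependent_matrixColumn {m n : ℕ} (u : Fin m → EuclideanSpace ℝ (Fin n))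
    (hu : (rowMatrix u).rank = n) : LinearIndependent ℝ (matrixColumn u) := by
  rw [linearIndependent_iff_card_eq_finrank_span, Set.finrank, span_range_matrixColumn,
    finrank_range_rowMap, hu, Fintype.card_fin]

/-- If `x` carries the signs of `α` on a `k`-set, then `⟨x, α⟩ = ⟨x - y, α⟩` is at most `ρ < 1/2`
times the ℓ¹-norm of `α`. Moving the part over the set to the left gives `θ = ρ / (1 - ρ) < 1`. -/
theorem exists_sum_abs_le_mul_sum_compl {m k : ℕ} (hkm : k ≤ m)
    {L : Submodule ℝ (EuclideanSpace ℝ (Fin m))}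
    (h : ∀ x ∈ signVectors m k, ∃ y ∈ Lᗮ, ∃ r < (1 / 2 : ℝ), ∀ i, |x i - y i| ≤ r) :
    ∃ θ : ℝ, 0 ≤ θ ∧ θ < 1 ∧ ∀ S : Finset (Fin m), S.card ≤ k → ∀ α ∈ L,
      ∑ i ∈ S, |α i| ≤ θ * ∑ i ∈ Sᶜ, |α i| := by
  have hfin : (signVectors m k).Finite := by
    have : ((WithLp.toLp 2) '' (Set.univ.pi fun _ : Fin m => ({0, 1, -1} : Set ℝ))).Finite :=
      (Set.Finite.pi fun _ => by simp).image _
    refine this.subset fun x hx => ⟨WithLp.ofLp x, fun i _ => ?_, rfl⟩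
    simpa using hx.1 i
  choose! y hy r hr hyr using h
  obtain ⟨ρ, hρ0, hρ1, hρ⟩ : ∃ ρ : ℝ, 0 ≤ ρ ∧ ρ < 1 / 2 ∧ ∀ x ∈ signVectors m k, r x ≤ ρ := by
    rcases (signVectors m k).eq_empty_or_nonempty with he | hne
    · exact ⟨0, le_rfl, by norm_num, by simp [he]⟩
    · obtain ⟨x, hx, hmax⟩ := Set.exists_max_image _ r hfin hne
      exact ⟨max 0 (r x), le_max_left _ _, max_lt (by norm_num) (hr x hx),
        fun z hz => (hmax z hz).trans (le_max_right _ _)⟩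
  have h1ρ : 0 < 1 - ρ := by linarith
  refine ⟨ρ / (1 - ρ), by positivity, by rw [div_lt_one h1ρ]; linarith, fun S hS α hα => ?_⟩
  -- The hypothesis concerns supports of size exactly `k`, so a smaller `S` is enlarged first.
  obtain ⟨S', hSS', hS'⟩ := Finset.exists_superset_card_eq hS (by simpa using hkm)
  set x : EuclideanSpace ℝ (Fin m) :=
    WithLp.toLp 2 fun i => if i ∈ S' then (if 0 ≤ α i then 1 else -1) else 0 with hxdef
  have hx : x ∈ signVectors m k := by
    refine ⟨fun i => ?_, ?_⟩
    · simp only [hxdef]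
      split_ifs <;> simp
    · rw [← hS', ← Set.ncard_coe_finset]
      congr 1
      ext i
      simp only [hxdef, Set.mem_ofPred_eq, Finset.mem_coe]
      split_ifs <;> simp_all
  have hxα : ∑ i, x i * α i = ∑ i ∈ S', |α i| := by
    rw [← Finset.sum_subset (Finset.subset_univ S')]
    · refine Finset.sum_congr rfl fun i hi => ?_
      simp only [hxdef, hi, if_true]
      split_ifs with h
      · rw [one_mul, abs_of_nonneg h]
      · rw [neg_one_mul, abs_of_neg (not_le.1 h)]
    · intro i _ hi
      simp [hxdef, hi]
  have hyα : ∑ i, y x i * α i = 0 := by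
    have := Submodule.inner_right_of_mem_orthogonal hα (hy x hx)
    rwa [PiLp.inner_apply] at this
  have hsum : ∑ i ∈ S', |α i| ≤ ρ * ∑ i, |α i| := by
    calc ∑ i ∈ S', |α i| = ∑ i, (x i - y x i) * α i := by
          simp only [sub_mul, Finset.sum_sub_distrib, hxα, hyα, sub_zero]
      _ ≤ ∑ i, ρ * |α i| := Finset.sum_le_sum fun i _ => by
          refine (le_abs_self _).trans ?_
          rw [abs_mul]
          exact mul_le_mul_of_nonneg_right ((hyr x hx i).trans (hρ x hx)) (abs_nonneg _)
      _ = ρ * ∑ i, |α i| := (Finset.mul_sum _ _ _).symm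
  have hle : ∑ i ∈ S, |α i| ≤ ∑ i ∈ S', |α i| :=
    Finset.sum_le_sum_of_subset_of_nonneg hSS' fun i _ _ => abs_nonneg _
  have hsplit := Finset.sum_add_sum_compl S fun i => |α i|
  rw [div_mul_eq_mul_div, le_div_iff₀ h1ρ]
  rw [← hsplit] at hsum
  nlinarith

/-- The desired `y` is a point of `Lᗮ` in the box with entries fixed to `x` on `S` and in `[-θ, θ]`
elsewhere. If there is none, 0 is separated from the projected box by some `α ∈ L`, which
contradicts the ℓ¹ estimate. -/
theorem exists_mem_orthogonal_eq_on {m : ℕ} {L : Submodule ℝ (EuclideanSpace ℝ (Fin m))}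
    {θ : ℝ} (hθ : 0 ≤ θ) {S : Finset (Fin m)}
    (h : ∀ α ∈ L, ∑ i ∈ S, |α i| ≤ θ * ∑ i ∈ Sᶜ, |α i|) {x : Fin m → ℝ} (hx : ∀ i, |x i| ≤ 1) :
    ∃ y ∈ Lᗮ, (∀ i ∈ S, y i = x i) ∧ ∀ i ∉ S, |y i| ≤ θ := by
  classical
  set lo : Fin m → ℝ := fun i => if i ∈ S then x i else -θ with hlo
  set hi : Fin m → ℝ := fun i => if i ∈ S then x i else θ with hhi
  set g : (Fin m → ℝ) →L[ℝ] L :=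
    L.orthogonalProjectionOnto ∘L (EuclideanSpace.equiv (Fin m) ℝ).symm.toContinuousLinearMap with hg
  by_cases h0 : (0 : L) ∈ g '' Set.Icc lo hi
  · obtain ⟨y, ⟨hy1, hy2⟩, hy⟩ := h0
    refine ⟨WithLp.toLp 2 y, Submodule.orthogonalProjectionOnto_eq_zero_iff.1 hy,
      fun i hiS => ?_, fun i hiS => ?_⟩
    · have h1 := hy1 i
      have h2 := hy2 i
      simp only [hlo, hhi, hiS, if_true] at h1 h2
      exact le_antisymm h2 h1
    · have h1 := hy1 i
      have h2 := hy2 i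
      simp only [hlo, hhi, hiS, if_false] at h1 h2
      exact abs_le.2 ⟨h1, h2⟩
  · exfalso
    obtain ⟨f, c, hf0, hf⟩ := geometric_hahn_banach_point_closed
      ((convex_Icc lo hi).linear_image g.toLinearMap)
      (isCompact_Icc.image g.continuous).isClosed h0
    rw [map_zero] at hf0
    set α : L := (InnerProductSpace.toDual ℝ L).symm f with hα
    -- The point of the box that minimises the pairing with `α`; there the pairing is at most 0.
    set z : Fin m → ℝ := fun i => if i ∈ S then x i else (if 0 ≤ α.1 i then -θ else θ) with hz
    have hzmem : z ∈ Set.Icc lo hi := by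
      constructor <;> intro i <;> simp only [hlo, hhi, hz] <;> split_ifs <;> linarith
    have hfz := hf _ ⟨z, hzmem, rfl⟩
    have hval : f (g z) = ∑ i, z i * α.1 i := by
      rw [← InnerProductSpace.toDual_symm_apply (𝕜 := ℝ)]
      change inner ℝ α (L.orthogonalProjectionOnto (WithLp.toLp 2 z)) = _
      rw [Submodule.inner_orthogonalProjectionOnto_eq_of_mem_left, PiLp.inner_apply]
      rfl
    have h1 : ∑ i ∈ S, z i * α.1 i ≤ ∑ i ∈ S, |α.1 i| := Finset.sum_le_sum fun i hiS => by
      simp only [hz, hiS, if_true]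
      refine (le_abs_self _).trans ?_
      rw [abs_mul]
      exact mul_le_of_le_one_left (abs_nonneg _) (hx i)
    have h2 : ∑ i ∈ Sᶜ, z i * α.1 i = -(θ * ∑ i ∈ Sᶜ, |α.1 i|) := by
      rw [Finset.mul_sum, ← Finset.sum_neg_distrib]
      refine Finset.sum_congr rfl fun i hiS => ?_
      simp only [hz, Finset.mem_compl.1 hiS, if_false]
      split_ifs with h
      · rw [abs_of_nonneg h]; ring
      · rw [abs_of_neg (not_le.1 h)]; ring
    have h3 := h α.1 α.2
    change c < f (g z) at hfz
    rw [hval, ← Finset.sum_add_sum_compl S, h2] at hfz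
    linarith

/-! ### Construction of the polytope. -/

/-- Take for `v i` the projection of the `i`-th basis vector to `Lᗮ`, identified isometrically with
`ℝ^d`. Then `∑ i, α i • v i` is the projection of `α`, which vanishes exactly on `L`, and pairing
with `y ∈ Lᗮ` takes the value `y i` at `v i`. -/
theorem exists_vectors_of_orthogonal {m d : ℕ} (L : Submodule ℝ (EuclideanSpace ℝ (Fin m)))
    (hL : finrank ℝ Lᗮ = d) :
    ∃ v : Fin m → EuclideanSpace ℝ (Fin d), linearDependences v = L ∧
      Submodule.span ℝ (Set.range v) = ⊤ ∧
      ∀ y ∈ Lᗮ, ∃ l : EuclideanSpace ℝ (Fin d) →L[ℝ] ℝ, ∀ i, l (v i) = y i := by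
  set V : EuclideanSpace ℝ (Fin d) ≃ₗᵢ[ℝ] Lᗮ :=
    ((stdOrthonormalBasis ℝ Lᗮ).reindex (finCongr hL)).repr.symm with hV
  set v : Fin m → EuclideanSpace ℝ (Fin d) := fun i =>
    V.symm (Lᗮ.orthogonalProjectionOnto (EuclideanSpace.single i 1)) with hv
  have hsum : ∀ α : EuclideanSpace ℝ (Fin m),
      ∑ i, α i • v i = V.symm (Lᗮ.orthogonalProjectionOnto α) := fun α => by
    have : α = ∑ i, α i • EuclideanSpace.single i (1 : ℝ) := by
      ext j
      simp [Finset.sum_apply, Pi.single_apply]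
    conv_rhs => rw [this]
    simp only [map_sum, map_smul, hv]
  refine ⟨v, ?_, ?_, ?_⟩
  · ext α
    change ∑ i, α i • v i = 0 ↔ _
    rw [hsum, LinearIsometryEquiv.map_eq_zero_iff, Submodule.orthogonalProjectionOnto_eq_zero_iff,
      Submodule.orthogonal_orthogonal]
  · rw [eq_top_iff]
    intro a _
    have : a = ∑ i, (V a : EuclideanSpace ℝ (Fin m)) i • v i := by
      rw [hsum, Submodule.orthogonalProjectionOnto_mem_subspace_eq_self, V.symm_apply_apply]
    rw [this]
    exact Submodule.sum_mem _ fun i _ =>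
      Submodule.smul_mem _ _ (Submodule.subset_span ⟨i, rfl⟩)
  · intro y hy
    refine ⟨innerSL ℝ (V.symm ⟨y, hy⟩), fun i => ?_⟩
    rw [innerSL_apply_apply, hv, LinearIsometryEquiv.inner_map_map,
      Submodule.inner_orthogonalProjectionOnto_eq_of_mem_left]
    exact (EuclideanSpace.inner_single_right i 1 y).trans (by simp)

/-- Any prescription of signs on at most `k` of the `v_i` is realised by a linear functional that
is smaller than `1` in absolute value on the remaining ones. -/
def SignsRealizable {m d : ℕ} (k : ℕ) (v : Fin m → EuclideanSpace ℝ (Fin d)) : Prop :=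
  ∀ S : Finset (Fin m), S.card ≤ k → ∀ x : Fin m → ℝ, (∀ i, |x i| ≤ 1) →
    ∃ l : EuclideanSpace ℝ (Fin d) →L[ℝ] ℝ,
      (∀ i ∈ S, l (v i) = x i) ∧ ∀ i ∉ S, |l (v i)| < 1

theorem plusMinus_finite {m d : ℕ} (v : Fin m → EuclideanSpace ℝ (Fin d)) :
    (plusMinus v).Finite := by
  rw [plusMinus_eq_range]
  exact Set.finite_range _

theorem neg_plusMinus {m d : ℕ} (v : Fin m → EuclideanSpace ℝ (Fin d)) :
    -plusMinus v = plusMinus v := by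
  ext x
  simp only [plusMinus, Set.mem_neg, Set.mem_ofPred_eq, neg_eq_iff_eq_neg, neg_neg]
  exact exists_congr fun i => or_comm

theorem isCentrallySymmetric_convexHull_plusMinus {m d : ℕ}
    (v : Fin m → EuclideanSpace ℝ (Fin d)) :
    IsCentrallySymmetric (convexHull ℝ (plusMinus v)) := by
  intro x
  rw [← Set.mem_neg, ← convexHull_neg, neg_plusMinus]

theorem affineSpan_convexHull_plusMinus {m d : ℕ} (hm : 1 ≤ m)
    {v : Fin m → EuclideanSpace ℝ (Fin d)} (hv : Submodule.span ℝ (Set.range v) = ⊤) :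
    affineSpan ℝ (convexHull ℝ (plusMinus v)) = ⊤ := by
  have h0 : (0 : EuclideanSpace ℝ (Fin d)) ∈ affineSpan ℝ (convexHull ℝ (plusMinus v)) := by
    have h1 : v ⟨0, hm⟩ ∈ convexHull ℝ (plusMinus v) := subset_convexHull ℝ _ ⟨_, Or.inl rfl⟩
    have h2 : -v ⟨0, hm⟩ ∈ convexHull ℝ (plusMinus v) := subset_convexHull ℝ _ ⟨_, Or.inr rfl⟩
    refine subset_affineSpan ℝ _ ?_
    have := (convex_convexHull ℝ (plusMinus v)) h1 h2 (a := 1 / 2) (b := 1 / 2) (by norm_num)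
      (by norm_num) (by norm_num)
    simpa using this
  rw [affineSpan_convexHull] at h0 ⊢
  rw [eq_top_iff]
  intro x _
  have hx : x ∈ Submodule.span ℝ (Set.range v) := hv ▸ Submodule.mem_top
  have hdir : Submodule.span ℝ (Set.range v) ≤ (affineSpan ℝ (plusMinus v)).direction := by
    rw [Submodule.span_le]
    rintro _ ⟨i, rfl⟩
    have := AffineSubspace.vsub_mem_direction
      (subset_affineSpan ℝ (plusMinus v) ⟨i, Or.inl rfl⟩ : v i ∈ _) h0
    simpa using this
  simpa using AffineSubspace.vadd_mem_of_mem_direction (hdir hx) h0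

theorem le_one_of_mem_convexHull_plusMinus {m d : ℕ} {v : Fin m → EuclideanSpace ℝ (Fin d)}
    {l : EuclideanSpace ℝ (Fin d) →L[ℝ] ℝ} (hl : ∀ i, |l (v i)| ≤ 1) :
    ∀ y ∈ convexHull ℝ (plusMinus v), l y ≤ 1 := by
  refine convexHull_min (t := {y | l y ≤ 1}) ?_ (convex_halfSpace_le l.isLinear 1)
  rintro y ⟨i, rfl | rfl⟩
  · exact (abs_le.1 (hl i)).2
  · simp only [Set.mem_ofPred_eq, map_neg]
    linarith [(abs_le.1 (hl i)).1]

theorem isExposed_functional_eq_one {m d : ℕ} {v : Fin m → EuclideanSpace ℝ (Fin d)}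
    {l : EuclideanSpace ℝ (Fin d) →L[ℝ] ℝ} (hl : ∀ i, |l (v i)| ≤ 1) :
    IsExposed ℝ (convexHull ℝ (plusMinus v)) {y ∈ convexHull ℝ (plusMinus v) | l y = 1} := by
  rintro ⟨z, hz, hz1⟩
  refine ⟨l, ?_⟩
  ext y
  refine and_congr_right fun hy => ⟨fun h w hw => ?_, fun h => ?_⟩
  · rw [h]
    exact le_one_of_mem_convexHull_plusMinus hl w hw
  · exact le_antisymm (le_one_of_mem_convexHull_plusMinus hl y hy) (hz1 ▸ h z hz)

theorem SignsRealizable.exists_functional_singleton {m d k : ℕ} (hk : 1 ≤ k)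
    {v : Fin m → EuclideanSpace ℝ (Fin d)} (h : SignsRealizable k v) (i : Fin m) :
    ∃ l : EuclideanSpace ℝ (Fin d) →L[ℝ] ℝ, l (v i) = 1 ∧ ∀ j ≠ i, |l (v j)| < 1 := by
  obtain ⟨l, h1, h2⟩ := h {i} (by simpa using hk) (fun _ => 1) (by simp)
  exact ⟨l, h1 i (Finset.mem_singleton_self i), fun j hj => h2 j (by simpa using hj)⟩

theorem SignsRealizable.injective {m d k : ℕ} (hk : 1 ≤ k)
    {v : Fin m → EuclideanSpace ℝ (Fin d)} (h : SignsRealizable k v) :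
    Function.Injective (Sum.elim v (-v)) := by
  rw [injective_sum_elim_neg_iff]
  constructor
  · intro i j hij
    obtain ⟨l, h1, h2⟩ := h.exists_functional_singleton hk i
    by_contra hne
    have := h2 j (Ne.symm hne)
    rw [← hij, h1] at this
    norm_num at this
  · intro i j hij
    obtain ⟨l, h1, h2⟩ := h.exists_functional_singleton hk i
    have hl := congrArg l hij
    rw [map_neg, h1] at hl
    by_cases hne : j = i
    · rw [hne, h1] at hl
      norm_num at hl
    · have := h2 j hne
      rw [show l (v j) = -1 by linarith] at this
      norm_num at this

theorem SignsRealizable.extremePoints_convexHull {m d k : ℕ} (hk : 1 ≤ k)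
    {v : Fin m → EuclideanSpace ℝ (Fin d)} (h : SignsRealizable k v) :
    (convexHull ℝ (plusMinus v)).extremePoints ℝ = plusMinus v := by
  have hpos : ∀ (i : Fin m) (s : ℝ), s = 1 ∨ s = -1 →
      s • v i ∈ (convexHull ℝ (plusMinus v)).extremePoints ℝ := by
    intro i s hs
    obtain ⟨l, h1, h2⟩ := h.exists_functional_singleton hk i
    have hle : ∀ j, |(s • l) (v j)| ≤ 1 := fun j => by
      have : |l (v j)| ≤ 1 := by
        by_cases hne : j = i
        · rw [hne, h1, abs_one]
        · exact (h2 j hne).le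
      rcases hs with rfl | rfl <;> simpa using this
    have hexp := isExposed_functional_eq_one hle
    have hcomp : IsCompact {y ∈ convexHull ℝ (plusMinus v) | (s • l) y = 1} :=
      ((plusMinus_finite v).isCompact_convexHull (𝕜 := ℝ)).inter_right
        (isClosed_eq (s • l).continuous continuous_const)
    have hne : {y ∈ convexHull ℝ (plusMinus v) | (s • l) y = 1}.Nonempty := by
      refine ⟨s • v i, subset_convexHull ℝ _ ⟨i, ?_⟩, ?_⟩
      · rcases hs with rfl | rfl <;> simp
      · rcases hs with rfl | rfl <;> simp [h1]
    -- An extreme point of this face is extreme in the hull, hence some `±v j`; the strict bounds on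
    -- `l` leave only `s • v i`.
    obtain ⟨z, hz⟩ := hcomp.extremePoints_nonempty hne
    have hzP := hexp.isExtreme.extremePoints_subset_extremePoints hz
    obtain ⟨j, hj⟩ := extremePoints_convexHull_subset hzP
    have hz1 : (s • l) z = 1 := hz.1.2
    have hz1' : s * l z = 1 := hz1
    have hji : j = i := by
      by_contra hne
      have hlt := abs_lt.1 (h2 j hne)
      rcases hs with rfl | rfl <;> rcases hj with rfl | rfl <;>
        simp only [map_neg, one_mul, neg_one_mul] at hz1' <;> linarith [hlt.1, hlt.2]
    subst hji
    rcases hs with rfl | rfl <;> rcases hj with rfl | rfl <;>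
      simp only [map_neg, h1] at hz1' <;> first | (norm_num at hz1'; done) | simpa using hzP
  refine Set.Subset.antisymm extremePoints_convexHull_subset ?_
  rintro y ⟨i, rfl | rfl⟩
  · simpa using hpos i 1 (Or.inl rfl)
  · simpa using hpos i (-1) (Or.inr rfl)

theorem SignsRealizable.isKNeighborly {m d k : ℕ} (hk : 1 ≤ k)
    {v : Fin m → EuclideanSpace ℝ (Fin d)} (h : SignsRealizable k v) :
    IsKNeighborly k (convexHull ℝ (plusMinus v)) := by
  classical
  obtain ⟨hinj, hneg⟩ := (injective_sum_elim_neg_iff v).1 (h.injective hk)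
  intro S hS hcard hanti
  rw [h.extremePoints_convexHull hk] at hS
  -- The default `-1` is harmless: if neither `v i` nor `-v i` is in `S`, then `i ∉ I`.
  set x : Fin m → ℝ := fun i => if v i ∈ S then 1 else -1 with hx
  have hx1 : ∀ i, |x i| ≤ 1 := fun i => by
    simp only [hx]; split_ifs <;> simp
  set I : Finset (Fin m) := Finset.univ.filter fun i => x i • v i ∈ S with hI
  have hmemI : ∀ i, i ∈ I ↔ x i • v i ∈ S := by simp [hI]
  have hIk : I.card ≤ k := by
    rw [← hcard]
    refine Finset.card_le_card_of_injOn (fun i => x i • v i) (fun i hi => (hmemI i).1 hi) ?_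
    intro i _ j _ hij
    simp only [hx] at hij
    split_ifs at hij
    · exact hinj (by simpa using hij)
    · exact absurd (by simpa using hij) (hneg i j)
    · exact absurd (by simpa using hij.symm) (hneg j i)
    · exact hinj (by simpa using hij)
  obtain ⟨l, h1, h2⟩ := h I hIk x hx1
  have hle : ∀ i, |l (v i)| ≤ 1 := fun i => by
    by_cases hi : i ∈ I
    · rw [h1 i hi]; exact hx1 i
    · exact (h2 i hi).le
  have hpm : ∀ i, v i ∈ S → -v i ∉ S := fun i hi hi' =>
    hanti _ hi _ hi' (hneg i i) rfl
  refine ⟨_, isExposed_functional_eq_one hle, ?_⟩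
  rw [(isExposed_functional_eq_one hle).isExtreme.extremePoints_eq,
    h.extremePoints_convexHull hk]
  ext y
  constructor
  · rintro ⟨⟨-, hy⟩, i, hi⟩
    have hiI : i ∈ I := by
      by_contra hiI
      have hlt := abs_lt.1 (h2 i hiI)
      rcases hi with rfl | rfl
      · linarith [hlt.2]
      · rw [map_neg] at hy
        linarith [hlt.1]
    have hxi := h1 i hiI
    have hmem := (hmemI i).1 hiI
    rcases hi with rfl | rfl
    · rw [hy] at hxi
      simpa [← hxi] using hmem
    · rw [map_neg] at hy
      rw [show l (v i) = -1 by linarith] at hxi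
      simpa [← hxi] using hmem
  · intro hy
    have hyv := hS hy
    refine ⟨⟨subset_convexHull ℝ _ hyv, ?_⟩, hyv⟩
    obtain ⟨i, rfl | rfl⟩ := hyv
    · have hxi : x i = 1 := if_pos hy
      rw [h1 i ((hmemI i).2 (by simpa [hxi] using hy)), hxi]
    · have hxi : x i = -1 := if_neg fun h' => hpm i h' hy
      rw [map_neg, h1 i ((hmemI i).2 (by simpa [hxi] using hy)), hxi, neg_neg]

/-! ### The equivalence. -/

theorem proposition3 (m n d k : ℕ) (hm : m = n + d) (hk : 1 ≤ k) (hkm : k ≤ m)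
    (u : Fin m → EuclideanSpace ℝ (Fin n)) (hrank : (rowMatrix u).rank = n) :
    (∃ P : Set (EuclideanSpace ℝ (Fin d)),
        IsFullDimPolytope P ∧ IsCentrallySymmetric P ∧ IsKNeighborly k P ∧
        (P.extremePoints ℝ).ncard = 2 * m ∧ IsCsTransformOfPolytope u P) ↔
      projOnto (LinearMap.range (rowMap u)) (polytopeE m k) ⊆
        interior (projOnto (LinearMap.range (rowMap u)) (cube (1 / 2) m)) := by
  rw [projOnto_polytopeE_subset_iff]
  constructor
  · rintro ⟨P, -, -, hP, hcard, v, hv, -, hspan⟩ x hx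
    rw [hv, ncard_plusMinus_iff, injective_sum_elim_neg_iff] at hcard
    obtain ⟨l, h1, h2⟩ := exists_functional_of_isKNeighborly hk hP hv hcard.1 hcard.2 hx
    obtain ⟨s, r, hr, hs⟩ := exists_scale_close (y := WithLp.toLp 2 fun i => l (v i)) hx h1 h2
    refine ⟨_, ?_, r, hr, hs⟩
    rw [← span_range_matrixColumn, hspan]
    exact Submodule.smul_mem _ _ (inner_mem_orthogonal_linearDependences v l)
  · intro h
    obtain ⟨θ, hθ0, hθ1, hθ⟩ := exists_sum_abs_le_mul_sum_compl hkm h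
    obtain ⟨v, hv, hspan, hl⟩ := exists_vectors_of_orthogonal (d := d)
      (LinearMap.range (rowMap u)) (Submodule.finrank_add_finrank_orthogonal' (by
        rw [finrank_range_rowMap, hrank, finrank_euclideanSpace_fin, hm]))
    have hreal : SignsRealizable k v := fun S hS x hx => by
      obtain ⟨y, hy, h1, h2⟩ := exists_mem_orthogonal_eq_on hθ0 (hθ S hS) hx
      obtain ⟨l, hl⟩ := hl y hy
      exact ⟨l, fun i hi => (hl i).trans (h1 i hi),
        fun i hi => by rw [hl i]; exact (h2 i hi).trans_lt hθ1⟩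
    have hext := hreal.extremePoints_convexHull hk
    refine ⟨convexHull ℝ (plusMinus v), ⟨⟨_, plusMinus_finite v, rfl⟩,
      affineSpan_convexHull_plusMinus (hk.trans hkm) hspan⟩,
      isCentrallySymmetric_convexHull_plusMinus v, hreal.isKNeighborly hk, ?_,
      v, hext, linearIndependent_matrixColumn u hrank, ?_⟩
    · rw [hext, ncard_plusMinus_iff]
      exact hreal.injective hk
    · rw [span_range_matrixColumn, hv]
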